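/- Let $\mathcal B$ be a unital $C^*$-algebra with unit $\mathbf 1$ (for example $\mathbb B(\mathfrak H)$) and let $\mathcal A\subseteq\mathcal B$ be a $C^*$-subalgebra, not necessarily containing $\mathbf 1$; the case $\mathcal A=\mathcal B$ is allowed. An abelian $n$-tuple in $\mathcal A$ is a tuple $\underline x=(x_1,\dots,x_n)$ of pairwise commuting self-adjoint elements of $\mathcal A$. Two abelian $n$-tuples $\underline x,\underline y$ are compatible if $(1-t)\underline x+t\underline y$ is an abelian $n$-tuple for every $t\in[0,1]$. If $f$ is a real function that is continuous on the joint spectrum of $\underline x$, then $f(\underline x)\in\mathcal B$ denotes the joint continuous functional calculus, i.e. the element of the commutative unital $C^*$-algebra generated by $\mathbf 1,x_1,\dots,x_n$ with $\chi(f(\underline x))=f(\chi(x_1),\dots,\chi(x_n))$ for every character $\chi$ of that algebra. The centralizer of a positive functional $\varphi$ on $\mathcal A$ is $\{y\in\mathcal A : \varphi(ay)=\varphi(ya)\text{ for all }a\in\mathcal A\}$. **Proposition 18.** Let $f$ be a continuous real function on the box $\underline I=[\alpha_1,\beta_1]\times\cdots\times[\alpha_n,\beta_n]\subset\mathbb R^n$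 that is increasing (in the weak sense) in each variable. Let $\underline x$ and $\underline y$ be compatible abelian $n$-tuples in $\mathcal A$ with $\alpha_i\mathbf 1\le x_i\le y_i\le\beta_i\mathbf 1$ for all $i$, and let $\varphi$ be a positive linear functional on $\mathcal A$ whose centralizer contains all the elements $x_1,\dots,x_n$ and $y_1,\dots,y_n$. Then $$\varphi(f(\underline x))\le\varphi(f(\underline y)).$$ Precisely: the inequality holds whenever $f(\underline x)$ and $f(\underline y)$ belong to $\mathcal A$ (automatic if $\mathbf 1\in\mathcal A$); and in general, for every positive linear functional $\psi$ on $\mathcal B$ that extends $\varphi$, one has $\psi(f(\underline x))\le\psi(f(\underline y))$. -/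

import Mathlib

open scoped ComplexOrder
open WeakDual

noncomputable section

/-- An abelian `n`-tuple: self-adjoint, pairwise commuting elements. -/
structure IsAbelianTuple {B : Type*} [CStarAlgebra B] {n : ℕ} (x : Fin n → B) : Prop where
  isSelfAdjoint : ∀ i, IsSelfAdjoint (x i)
  commute : ∀ i j, x i * x j = x j * x i

/-- Two abelian `n`-tuples are compatible if the whole line segment between them consists of
abelian `n`-tuples. -/
def AreCompatible {B : Type*} [CStarAlgebra B] {n : ℕ} (x y : Fin n → B) : Prop :=
  ∀ t ∈ Set.Icc (0 : ℝ) 1, IsAbelianTuple ((1 - t) • x + t • y)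

/-- The unital C*-subalgebra generated by `x 1, …, x n`. -/
def generatedAlgebra {B : Type*} [CStarAlgebra B] {n : ℕ} (x : Fin n → B) :
    StarSubalgebra ℂ B :=
  (StarAlgebra.adjoin ℂ (Set.range x)).topologicalClosure

instance generatedAlgebra_isClosed {B : Type*} [CStarAlgebra B] {n : ℕ} (x : Fin n → B) :
    IsClosed (generatedAlgebra x : Set B) :=
  StarSubalgebra.isClosed_topologicalClosure _

theorem mem_generatedAlgebra {B : Type*} [CStarAlgebra B] {n : ℕ} (x : Fin n → B) (i : Fin n) :
    x i ∈ generatedAlgebra x :=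
  StarSubalgebra.le_topologicalClosure _ (StarAlgebra.subset_adjoin ℂ _ ⟨i, rfl⟩)

theorem generatedAlgebra_mul_comm {B : Type*} [CStarAlgebra B] {n : ℕ} {x : Fin n → B}
    (hx : IsAbelianTuple x) (a b : generatedAlgebra x) : a * b = b * a := by
  have h : ∀ a ∈ Set.range x, ∀ b ∈ Set.range x, a * b = b * a := by
    rintro _ ⟨i, rfl⟩ _ ⟨j, rfl⟩
    exact hx.commute i j
  have h' : ∀ a ∈ Set.range x, ∀ b ∈ Set.range x, a * star b = star b * a := by
    rintro _ ⟨i, rfl⟩ _ ⟨j, rfl⟩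
    rw [(hx.isSelfAdjoint j).star_eq]
    exact hx.commute i j
  have hc := StarAlgebra.isMulCommutative_adjoin ℂ h h'
  exact (StarSubalgebra.commRingTopologicalClosure (StarAlgebra.adjoin ℂ (Set.range x))
    (fun a b => hc.is_comm.comm a b)).mul_comm a b

/-- The unital C*-algebra generated by an abelian tuple is a commutative C*-algebra. -/
abbrev generatedCommCStarAlgebra {B : Type*} [CStarAlgebra B] {n : ℕ} {x : Fin n → B}
    (hx : IsAbelianTuple x) : CommCStarAlgebra (generatedAlgebra x) :=
  { StarSubalgebra.cstarAlgebra (generatedAlgebra x) with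
    mul_comm := generatedAlgebra_mul_comm hx }

/-- The point `(χ (x 1), …, χ (x n))` of `ℝⁿ` given by a character `χ` of the C*-algebra
generated by the tuple `x` (each `χ (x i)` is real when `x i` is self-adjoint). -/
def characterPoint {B : Type*} [CStarAlgebra B] {n : ℕ} (x : Fin n → B)
    (χ : characterSpace ℂ (generatedAlgebra x)) : Fin n → ℝ :=
  fun i => (χ ⟨x i, mem_generatedAlgebra x i⟩).re

/-- The joint spectrum of an abelian tuple. -/
def jointSpectrum {B : Type*} [CStarAlgebra B] {n : ℕ} (x : Fin n → B) : Set (Fin n → ℝ) :=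
  Set.range (characterPoint x)

theorem continuous_characterPoint {B : Type*} [CStarAlgebra B] {n : ℕ} (x : Fin n → B) :
    Continuous (characterPoint x) :=
  continuous_pi fun _ => Complex.continuous_re.comp
    ((WeakDual.eval_continuous _).comp continuous_subtype_val)

/-- `f` as a continuous function on the Gelfand spectrum of the algebra generated by `x`. -/
def symbolMap {B : Type*} [CStarAlgebra B] {n : ℕ} (x : Fin n → B)
    (f : (Fin n → ℝ) → ℝ) (hf : ContinuousOn f (jointSpectrum x)) :
    C(characterSpace ℂ (generatedAlgebra x), ℂ) where
  toFun χ := (f (characterPoint x χ) : ℂ)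
  continuous_toFun := Complex.continuous_ofReal.comp
    (hf.comp_continuous (continuous_characterPoint x) fun χ => ⟨χ, rfl⟩)

open Classical in
/-- The functional calculus `f(x) = f(x 1, …, x n)` of an abelian tuple `x`: the element of the
commutative unital C*-algebra generated by `x` whose Gelfand transform is
`χ ↦ f (χ (x 1), …, χ (x n))`. The value is `0` by convention if `x` is not abelian or `f` is not
continuous on the joint spectrum of `x`. -/
def jointCFC {B : Type*} [CStarAlgebra B] {n : ℕ} (f : (Fin n → ℝ) → ℝ) (x : Fin n → B) : B :=
  if h : IsAbelianTuple x ∧ ContinuousOn f (jointSpectrum x) then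
    letI := generatedCommCStarAlgebra h.1
    (((gelfandStarTransform (generatedAlgebra x)).symm (symbolMap x f h.2) :
      generatedAlgebra x) : B)
  else 0

/-- `f` is increasing in each variable on the set `I`. -/
def IncreasingInEachVariableOn {n : ℕ} (f : (Fin n → ℝ) → ℝ) (I : Set (Fin n → ℝ)) : Prop :=
  ∀ u ∈ I, ∀ (i : Fin n) (t : ℝ), Function.update u i t ∈ I → u i ≤ t →
    f u ≤ f (Function.update u i t)

/-- A linear functional on a C*-algebra is positive if `0 ≤ φ (a* a)` for all `a`. -/
def IsPositiveFunctional {A : Type*} [NonUnitalRing A] [StarRing A] [Module ℂ A]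
    (φ : A →ₗ[ℂ] ℂ) : Prop :=
  ∀ a : A, 0 ≤ φ (star a * a)

/-- The centralizer of a functional `φ`. -/
def functionalCentralizer {A : Type*} [NonUnitalRing A] [Module ℂ A] (φ : A →ₗ[ℂ] ℂ) : Set A :=
  {y | ∀ a : A, φ (a * y) = φ (y * a)}

/-! The functional calculus has the expected defining properties. -/

theorem jointCFC_eq {B : Type*} [CStarAlgebra B] {n : ℕ} {f : (Fin n → ℝ) → ℝ} {x : Fin n → B}
    (hx : IsAbelianTuple x) (hf : ContinuousOn f (jointSpectrum x)) :
    jointCFC f x = (letI := generatedCommCStarAlgebra hx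
      (((gelfandStarTransform (generatedAlgebra x)).symm (symbolMap x f hf) :
        generatedAlgebra x) : B)) :=
  dif_pos ⟨hx, hf⟩

theorem jointCFC_mem {B : Type*} [CStarAlgebra B] {n : ℕ} (f : (Fin n → ℝ) → ℝ) (x : Fin n → B) :
    jointCFC f x ∈ generatedAlgebra x := by
  unfold jointCFC
  split_ifs with h
  · exact Subtype.property _
  · exact zero_mem _

theorem character_jointCFC {B : Type*} [CStarAlgebra B] {n : ℕ} {f : (Fin n → ℝ) → ℝ}
    {x : Fin n → B} (hx : IsAbelianTuple x) (hf : ContinuousOn f (jointSpectrum x))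
    (χ : characterSpace ℂ (generatedAlgebra x)) :
    χ ⟨jointCFC f x, jointCFC_mem f x⟩ = (f (characterPoint x χ) : ℂ) := by
  let _ := generatedCommCStarAlgebra hx
  have h := (gelfandStarTransform (generatedAlgebra x)).apply_symm_apply (symbolMap x f hf)
  have h1 : (⟨jointCFC f x, jointCFC_mem f x⟩ : generatedAlgebra x) =
      (gelfandStarTransform (generatedAlgebra x)).symm (symbolMap x f hf) :=
    Subtype.ext (jointCFC_eq hx hf)
  rw [h1]
  exact congrArg (fun g : C(characterSpace ℂ (generatedAlgebra x), ℂ) => g χ) h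

theorem jointCFC_coord {B : Type*} [CStarAlgebra B] {n : ℕ} {x : Fin n → B}
    (hx : IsAbelianTuple x) (i : Fin n) : jointCFC (fun u => u i) x = x i := by
  let _ := generatedCommCStarAlgebra hx
  have hf : ContinuousOn (fun u : Fin n → ℝ => u i) (jointSpectrum x) :=
    (continuous_apply i).continuousOn
  have h1 : (⟨jointCFC (fun u => u i) x, jointCFC_mem _ x⟩ : generatedAlgebra x) =
      ⟨x i, mem_generatedAlgebra x i⟩ := by
    apply (gelfandStarTransform (generatedAlgebra x)).injective
    ext χ
    refine (character_jointCFC hx hf χ).trans ?_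
    have hsa : star (⟨x i, mem_generatedAlgebra x i⟩ : generatedAlgebra x) =
        ⟨x i, mem_generatedAlgebra x i⟩ := Subtype.ext (hx.isSelfAdjoint i).star_eq
    have h2 : star (χ ⟨x i, mem_generatedAlgebra x i⟩) = χ ⟨x i, mem_generatedAlgebra x i⟩ := by
      rw [← map_star χ, hsa]
    exact Complex.conj_eq_iff_re.mp h2
  exact congrArg Subtype.val h1

/-- If `α i ≤ x i ≤ β i` for all `i`, the joint spectrum lies in the box `∏ [α i, β i]`. -/
theorem jointSpectrum_subset_Icc {B : Type*} [CStarAlgebra B] [PartialOrder B] [StarOrderedRing B]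
    {n : ℕ} {x : Fin n → B} {α β : Fin n → ℝ} (hx : IsAbelianTuple x)
    (hα : ∀ i, algebraMap ℝ B (α i) ≤ x i) (hβ : ∀ i, x i ≤ algebraMap ℝ B (β i)) :
    jointSpectrum x ⊆ Set.Icc α β := by
  rintro _ ⟨χ, rfl⟩
  have key : ∀ i, characterPoint x χ i ∈ spectrum ℝ (x i) := by
    intro i
    rw [← (hx.isSelfAdjoint i).spectrumRestricts.image]
    refine ⟨χ ⟨x i, mem_generatedAlgebra x i⟩, ?_, rfl⟩
    have h1 := WeakDual.CharacterSpace.apply_mem_spectrum χ ⟨x i, mem_generatedAlgebra x i⟩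
    rwa [StarSubalgebra.spectrum_eq (S := generatedAlgebra x)] at h1
  refine ⟨fun i => ?_, fun i => ?_⟩
  · exact (algebraMap_le_iff_le_spectrum (ha := hx.isSelfAdjoint i)).mp (hα i) _ (key i)
  · exact (le_algebraMap_iff_spectrum_le (ha := hx.isSelfAdjoint i)).mp (hβ i) _ (key i)

end

/-!
Write `d i = y i - x i` and `X t = x + t d`. For a polynomial `p`, the derivative of `p (X t)` is a
sum of words in which one factor is a `d i` and the others commute with each other. A functional
whose centralizer contains the `x i` and `y i` can rotate such words, so that
`d/dt φ (p (X t)) = ∑ i, φ ((∂ᵢ p) (X t) * d i)` (`exists_hasDerivAt_polyCFC`). If `∂ᵢ p ≥ 0` on the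
box, then `(∂ᵢ p) (X t) = h⋆ h`, and with `s` the square root of `d i ≥ 0`, which again lies in the
centralizer, `φ (h⋆ h s s) = φ ((h s)⋆ (h s)) ≥ 0` (`nonneg_map_star_mul_self_mul`). Hence
`φ (p (x)) ≤ φ (p (y))` for such `p`.

An increasing continuous function on a box is a uniform limit of such polynomials: its multivariate
Bernstein polynomials have nonnegative partial derivatives
(`exists_mvPolynomial_increasing_close`).

The subalgebra `A` need not contain the unit, so `p (x)` need not lie in `A`. However, the difference
`p (y) - p (x)` does, and by closedness so does `f (y) - f (x)`; the whole argument evaluates the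
functional at elements of `A` only. Accordingly tracial cyclicity is formulated for the unital
algebra `relativeCentralizer` of elements that multiply `A` into itself, which contains all
functions of the `X t`.
-/

/-! ### Monotone polynomial approximation -/

theorem bernsteinPolynomial_eval_nonneg (N l : ℕ) {v : ℝ} (hv : v ∈ Set.Icc (0 : ℝ) 1) :
    0 ≤ (bernsteinPolynomial ℝ N l).eval v := by
  have h0 := hv.1
  have h1 : 0 ≤ 1 - v := sub_nonneg.2 hv.2
  simp only [bernsteinPolynomial, Polynomial.eval_mul, Polynomial.eval_natCast,
    Polynomial.eval_pow, Polynomial.eval_X, Polynomial.eval_sub, Polynomial.eval_one]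
  positivity

/-- The Bernstein derivative `B_N(c)' = N ∑ (c (l+1) - c l) b_{N-1,l}` is nonnegative on `[0,1]`
for increasing coefficients `c`. -/
theorem sum_mul_eval_derivative_bernstein_nonneg (N : ℕ) (c : ℕ → ℝ)
    (hc : ∀ l < N, c l ≤ c (l + 1)) {v : ℝ} (hv : v ∈ Set.Icc (0 : ℝ) 1) :
    0 ≤ ∑ l ∈ Finset.range (N + 1),
      c l * ((bernsteinPolynomial ℝ N l).derivative).eval v := by
  rcases N with - | M
  · simp [bernsteinPolynomial]
  have key : ∀ m, ∑ l ∈ Finset.range (m + 1),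
      c l * ((bernsteinPolynomial ℝ (M + 1) l).derivative).eval v =
      (M + 1) * ∑ l ∈ Finset.range m, (c (l + 1) - c l) * (bernsteinPolynomial ℝ M l).eval v
        - (M + 1) * c m * (bernsteinPolynomial ℝ M m).eval v := by
    intro m
    induction m with
    | zero => simp [bernsteinPolynomial.derivative_zero]; ring
    | succ m ih =>
      rw [Finset.sum_range_succ, ih, Finset.sum_range_succ, bernsteinPolynomial.derivative_succ]
      simp
      ring
  rw [key, bernsteinPolynomial.eq_zero_of_lt ℝ (Nat.lt_succ_self M)]
  simp only [Polynomial.eval_zero, mul_zero, sub_zero]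
  refine mul_nonneg (by positivity) (Finset.sum_nonneg fun l hl => mul_nonneg ?_ ?_)
  · exact sub_nonneg.2 (hc l (Finset.mem_range.1 hl))
  · exact bernsteinPolynomial_eval_nonneg M l hv

/-- Separate the `i`-th index in a sum over multi-indices weighted by a product. -/
theorem sum_mul_prod_eq_split {ι κ : Type*} [Fintype ι] [DecidableEq ι] [Fintype κ]
    (i : ι) (H : (ι → κ) → ℝ) (b : ι → κ → ℝ) :
    ∑ k : ι → κ, H k * ∏ j, b j (k j) =
      ∑ k' : {j // j ≠ i} → κ, (∏ j : {j // j ≠ i}, b j (k' j)) *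
        ∑ l, H ((Equiv.funSplitAt i κ).symm (l, k')) * b i l := by
  rw [← (Equiv.funSplitAt i κ).symm.sum_comp, Fintype.sum_prod_type_right]
  refine Finset.sum_congr rfl fun k' _ => ?_
  rw [Finset.mul_sum]
  refine Finset.sum_congr rfl fun l _ => ?_
  rw [Fintype.prod_eq_mul_prod_subtype_ne _ i]
  have : ∀ j : {j // j ≠ i}, (Equiv.funSplitAt i κ).symm (l, k') j = k' j := by
    intro j
    simp [Equiv.funSplitAt_symm_apply, j.2]
  simp only [this]
  simp [Equiv.funSplitAt_symm_apply]
  ring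

/-- The Bernstein polynomial of degree `N` in each variable attached to `F` on the unit cube. For
`N = 0` the only node is the origin. -/
noncomputable def mvBernstein {ι : Type*} [Fintype ι] [DecidableEq ι] (N : ℕ) (F : (ι → ℝ) → ℝ) :
    MvPolynomial ι ℝ :=
  ∑ k : ι → Fin (N + 1), MvPolynomial.C (F fun j => (k j : ℝ) / N) *
    ∏ j, Polynomial.aeval (MvPolynomial.X j) (bernsteinPolynomial ℝ N (k j))

theorem eval_aeval_X {ι : Type*} (v : ι → ℝ) (j : ι) (P : Polynomial ℝ) :
    MvPolynomial.eval v (Polynomial.aeval (MvPolynomial.X j) P) = P.eval (v j) := by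
  rw [← MvPolynomial.coe_aeval_eq_eval, RingHom.coe_coe, ← Polynomial.aeval_algHom_apply]
  simp

theorem eval_mvBernstein {ι : Type*} [Fintype ι] [DecidableEq ι] (N : ℕ)
    (F : (ι → ℝ) → ℝ) (v : ι → ℝ) :
    MvPolynomial.eval v (mvBernstein N F) = ∑ k : ι → Fin (N + 1), F (fun j => (k j : ℝ) / N) *
      ∏ j, (bernsteinPolynomial ℝ N (k j)).eval (v j) := by
  simp [mvBernstein, eval_aeval_X]

theorem pderiv_aeval_X {ι : Type*} [DecidableEq ι] (i j : ι) (P : Polynomial ℝ) :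
    MvPolynomial.pderiv i (Polynomial.aeval (MvPolynomial.X j) P : MvPolynomial ι ℝ) =
      if j = i then Polynomial.aeval (MvPolynomial.X j) P.derivative else 0 := by
  rw [Derivation.map_aeval, MvPolynomial.pderiv_X]
  split_ifs with h
  · subst h; simp
  · simp [h]

theorem eval_pderiv_mvBernstein {ι : Type*} [Fintype ι] [DecidableEq ι] (N : ℕ)
    (F : (ι → ℝ) → ℝ) (v : ι → ℝ) (i : ι) :
    MvPolynomial.eval v (MvPolynomial.pderiv i (mvBernstein N F)) =
      ∑ k : ι → Fin (N + 1), F (fun j => (k j : ℝ) / N) *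
      ∏ j, if j = i then (bernsteinPolynomial ℝ N (k j)).derivative.eval (v j)
        else (bernsteinPolynomial ℝ N (k j)).eval (v j) := by
  have hrest : ∀ k : ι → Fin (N + 1), MvPolynomial.pderiv i
      (∏ j : {j // j ≠ i}, Polynomial.aeval (MvPolynomial.X (R := ℝ) j.1)
        (bernsteinPolynomial ℝ N (k j.1))) = 0 := by
    intro k
    refine Finset.prod_induction _ (fun q => MvPolynomial.pderiv i q = 0) ?_ ?_ ?_
    · intro a b ha hb
      rw [Derivation.leibniz, ha, hb]
      simp
    · exact Derivation.map_one_eq_zero _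
    · intro j _
      rw [pderiv_aeval_X, if_neg j.2]
  simp only [mvBernstein, map_sum]
  refine Finset.sum_congr rfl fun k _ => ?_
  rw [Fintype.prod_eq_mul_prod_subtype_ne _ i, Fintype.prod_eq_mul_prod_subtype_ne _ i]
  rw [← MvPolynomial.smul_eq_C_mul, Derivation.map_smul,
    Derivation.leibniz, hrest, pderiv_aeval_X]
  have : ∀ j : {j // j ≠ i}, (if j.1 = i then
      (bernsteinPolynomial ℝ N (k j.1)).derivative.eval (v j.1)
        else (bernsteinPolynomial ℝ N (k j.1)).eval (v j.1)) =
        (bernsteinPolynomial ℝ N (k j.1)).eval (v j.1) := fun j => if_neg j.2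
  simp only [this]
  simp [-mul_eq_mul_left_iff, MvPolynomial.smul_eval, eval_aeval_X]
  ring

theorem div_mem_unitInterval {N : ℕ} (l : Fin (N + 1)) : (l : ℝ) / N ∈ Set.Icc (0 : ℝ) 1 :=
  ⟨by positivity, div_le_one_of_le₀ (by exact_mod_cast l.is_le) (by positivity)⟩

/-- Bernstein polynomials of increasing functions are increasing to first order: after separating
the `i`-th index, the one-variable statement applies to each inner sum. -/
theorem eval_pderiv_mvBernstein_nonneg {n : ℕ} (N : ℕ) {F : (Fin n → ℝ) → ℝ}
    (hF : IncreasingInEachVariableOn F (Set.Icc 0 1)) {v : Fin n → ℝ} (hv : v ∈ Set.Icc 0 1)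
    (i : Fin n) : 0 ≤ MvPolynomial.eval v (MvPolynomial.pderiv i (mvBernstein N F)) := by
  rw [eval_pderiv_mvBernstein]
  rw [sum_mul_prod_eq_split i (fun k : Fin n → Fin (N + 1) => F fun j => (k j : ℝ) / N)
    (fun j (l : Fin (N + 1)) => if j = i then (bernsteinPolynomial ℝ N l).derivative.eval (v j)
        else (bernsteinPolynomial ℝ N l).eval (v j))]
  refine Finset.sum_nonneg fun k' _ => mul_nonneg (Finset.prod_nonneg fun j _ => ?_) ?_
  · rw [if_neg j.2]
    exact bernsteinPolynomial_eval_nonneg N _ ⟨hv.1 _, hv.2 _⟩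
  set g : (Fin n → ℝ) := fun j => if h : j = i then 0 else (k' ⟨j, h⟩ : ℝ) / N with hg
  have hgl : ∀ l : Fin (N + 1),
      (fun j => (((Equiv.funSplitAt i (Fin (N + 1))).symm (l, k') j : Fin (N + 1)) : ℝ) / N) =
        Function.update g i ((l : ℕ) / N : ℝ) := by
    intro l
    ext j
    by_cases h : j = i
    · subst h; simp [Equiv.funSplitAt_symm_apply]
    · simp [Equiv.funSplitAt_symm_apply, h, hg]
  simp only [hgl, if_true]
  rw [← Finset.sum_range (f := fun l : ℕ => F (Function.update g i ((l : ℝ) / N)) *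
    (bernsteinPolynomial ℝ N l).derivative.eval (v i))]
  have hmem : ∀ l ≤ N, Function.update g i ((l : ℝ) / N) ∈ Set.Icc (0 : Fin n → ℝ) 1 := by
    intro l hl
    have : ∀ j, Function.update g i ((l : ℝ) / N) j ∈ Set.Icc (0 : ℝ) 1 := by
      intro j
      by_cases h : j = i
      · subst h
        simpa using div_mem_unitInterval (⟨l, Nat.lt_succ_of_le hl⟩ : Fin (N + 1))
      · simpa [h, hg] using div_mem_unitInterval (k' ⟨j, h⟩)
    exact ⟨fun j => (this j).1, fun j => (this j).2⟩
  refine sum_mul_eval_derivative_bernstein_nonneg N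
    (fun l : ℕ => F (Function.update g i ((l : ℝ) / N))) (fun l hl => ?_) ⟨hv.1 i, hv.2 i⟩
  have := hF _ (hmem l hl.le) i (((l + 1 : ℕ) : ℝ) / N) (by
    rw [Function.update_idem]; exact hmem (l + 1) hl) (by
    rw [Function.update_self]; gcongr; simp)
  rwa [Function.update_idem] at this

theorem sum_eval_bernsteinPolynomial (N : ℕ) (v : ℝ) :
    ∑ l : Fin (N + 1), (bernsteinPolynomial ℝ N l).eval v = 1 := by
  have := congrArg (Polynomial.eval v) (bernsteinPolynomial.sum ℝ N)
  rw [Polynomial.eval_finsetSum, Finset.sum_range] at this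
  simpa using this

theorem sum_prod_eval_bernsteinPolynomial {ι : Type*} [Fintype ι] [DecidableEq ι] (N : ℕ)
    (v : ι → ℝ) :
    ∑ k : ι → Fin (N + 1), ∏ j, (bernsteinPolynomial ℝ N (k j)).eval (v j) = 1 := by
  have := Finset.prod_univ_sum (fun _ : ι => (Finset.univ : Finset (Fin (N + 1))))
    (fun j (l : Fin (N + 1)) => (bernsteinPolynomial ℝ N l).eval (v j))
  rw [Fintype.piFinset_univ] at this
  rw [← this]
  exact Finset.prod_eq_one fun j _ => sum_eval_bernsteinPolynomial N (v j)

/-- The second moment of the `i`-th coordinate of the node about `v i`, for the Bernstein weights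
at `v`. -/
theorem sum_sq_mul_prod_bernstein_le {ι : Type*} [Fintype ι] [DecidableEq ι] {N : ℕ} (hN : N ≠ 0)
    {v : ι → ℝ} (hv : v ∈ Set.Icc 0 1) (i : ι) :
    ∑ k : ι → Fin (N + 1), ((k i : ℝ) / N - v i) ^ 2 *
      ∏ j, (bernsteinPolynomial ℝ N (k j)).eval (v j) ≤ 1 / N := by
  rw [sum_mul_prod_eq_split i
    (fun k : ι → Fin (N + 1) => ((k i : ℝ) / N - v i) ^ 2)
    (fun j (l : Fin (N + 1)) => (bernsteinPolynomial ℝ N l).eval (v j))]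
  have h := bernstein.variance hN ⟨v i, hv.1 i, hv.2 i⟩
  have h' : ∑ l : Fin (N + 1), ((l : ℝ) / N - v i) ^ 2 * (bernsteinPolynomial ℝ N l).eval (v i) =
      v i * (1 - v i) / N := by
    rw [← h]
    refine Finset.sum_congr rfl fun l _ => ?_
    rw [bernstein_apply, bernstein.z]
    simp only [bernsteinPolynomial, Polynomial.eval_mul, Polynomial.eval_natCast,
      Polynomial.eval_pow, Polynomial.eval_X, Polynomial.eval_sub, Polynomial.eval_one]
    ring
  have h2 := sum_prod_eval_bernsteinPolynomial N (fun j : {j // j ≠ i} => v j)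
  simp only [Equiv.funSplitAt_symm_apply, dif_pos]
  rw [h', ← Finset.sum_mul, h2, one_mul]
  have h0 : 0 ≤ v i := hv.1 i
  have h1 : v i ≤ 1 := hv.2 i
  gcongr
  nlinarith

/-- Multivariate Bernstein theorem on the unit cube, by Chebyshev's inequality. -/
theorem exists_mvBernstein_close {n : ℕ} {F : (Fin n → ℝ) → ℝ}
    (hF : ContinuousOn F (Set.Icc 0 1)) {ε : ℝ} (hε : 0 < ε) :
    ∃ N, ∀ v ∈ Set.Icc (0 : Fin n → ℝ) 1,
      |MvPolynomial.eval v (mvBernstein N F) - F v| ≤ ε := by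
  have hcomp : IsCompact (Set.Icc (0 : Fin n → ℝ) 1) := isCompact_Icc
  obtain ⟨M, hM⟩ := hcomp.exists_bound_of_continuousOn hF
  have hM0 : 0 ≤ M := (norm_nonneg _).trans (hM 0 ⟨le_rfl, zero_le_one⟩)
  obtain ⟨δ, hδ, hunif⟩ := Metric.uniformContinuousOn_iff.1
    (hcomp.uniformContinuousOn_of_continuous hF) (ε / 2) (half_pos hε)
  set K := 2 * M / δ ^ 2 with hK
  have hK0 : 0 ≤ K := by positivity
  have hpt : ∀ a ∈ Set.Icc (0 : Fin n → ℝ) 1, ∀ b ∈ Set.Icc (0 : Fin n → ℝ) 1,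
      |F a - F b| ≤ ε / 2 + K * ∑ i, (a i - b i) ^ 2 := by
    intro a ha b hb
    by_cases hd : dist a b < δ
    · have := hunif a ha b hb hd
      rw [Real.dist_eq] at this
      have : 0 ≤ K * ∑ i, (a i - b i) ^ 2 :=
        mul_nonneg hK0 (Finset.sum_nonneg fun i _ => sq_nonneg _)
      linarith
    · rw [dist_pi_lt_iff hδ] at hd
      push Not at hd
      obtain ⟨i, hi⟩ := hd
      have h1 : δ ^ 2 ≤ (a i - b i) ^ 2 := by
        rw [← sq_abs (a i - b i), ← Real.dist_eq]
        gcongr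
      have h2 : δ ^ 2 ≤ ∑ i, (a i - b i) ^ 2 := h1.trans
        (Finset.single_le_sum (f := fun i => (a i - b i) ^ 2) (fun i _ => sq_nonneg _)
          (Finset.mem_univ i))
      have h3 : 2 * M ≤ K * ∑ i, (a i - b i) ^ 2 := by
        calc 2 * M = K * δ ^ 2 := by rw [hK]; field_simp
          _ ≤ _ := by gcongr
      have h4 : |F a - F b| ≤ M + M := (abs_sub _ _).trans (add_le_add (hM a ha) (hM b hb))
      linarith
  -- `N` is chosen so that the Chebyshev term `K * n / N` is at most `ε / 2`.
  obtain ⟨N, hN⟩ := exists_nat_gt (max 0 (2 * K * n / ε))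
  have hN0 : (0 : ℝ) < N := (le_max_left _ _).trans_lt hN
  have hN1 : 2 * K * n / ε < N := (le_max_right _ _).trans_lt hN
  refine ⟨N, fun v hv => ?_⟩
  set w : (Fin n → Fin (N + 1)) → ℝ := fun k =>
    ∏ j, (bernsteinPolynomial ℝ N (k j)).eval (v j) with hw
  have hw0 : ∀ k, 0 ≤ w k := fun k => Finset.prod_nonneg fun j _ =>
    bernsteinPolynomial_eval_nonneg N _ ⟨hv.1 j, hv.2 j⟩
  have hw1 : ∑ k, w k = 1 := sum_prod_eval_bernsteinPolynomial N v
  have hsq : ∀ i, ∑ k, ((k i : ℝ) / N - v i) ^ 2 * w k ≤ 1 / N :=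
    sum_sq_mul_prod_bernstein_le (by exact_mod_cast hN0.ne') hv
  have hnode : ∀ k : Fin n → Fin (N + 1),
      (fun j => (k j : ℝ) / N) ∈ Set.Icc (0 : Fin n → ℝ) 1 := fun k =>
    ⟨fun j => (div_mem_unitInterval (k j)).1, fun j => (div_mem_unitInterval (k j)).2⟩
  calc |MvPolynomial.eval v (mvBernstein N F) - F v|
      = |∑ k : Fin n → Fin (N + 1), (F (fun j => (k j : ℝ) / N) - F v) * w k| := by
        rw [eval_mvBernstein]
        simp only [sub_mul, Finset.sum_sub_distrib, ← Finset.mul_sum, hw1, mul_one]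
        simp only [hw]
    _ ≤ ∑ k : Fin n → Fin (N + 1), |(F (fun j => (k j : ℝ) / N) - F v) * w k| :=
        Finset.abs_sum_le_sum_abs _ _
    _ ≤ ∑ k : Fin n → Fin (N + 1), (ε / 2 + K * ∑ i, ((k i : ℝ) / N - v i) ^ 2) * w k := by
        refine Finset.sum_le_sum fun k _ => ?_
        rw [abs_mul, abs_of_nonneg (hw0 k)]
        exact mul_le_mul_of_nonneg_right (hpt _ (hnode k) v hv) (hw0 k)
    _ = ε / 2 + K * ∑ i, ∑ k : Fin n → Fin (N + 1), ((k i : ℝ) / N - v i) ^ 2 * w k := by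
        rw [Finset.sum_comm]
        simp only [add_mul, Finset.sum_add_distrib, ← Finset.mul_sum, hw1, mul_one, mul_assoc,
          Finset.sum_mul]
    _ ≤ ε / 2 + K * ∑ i : Fin n, (1 / N : ℝ) := by
        gcongr with i
        exact hsq i
    _ ≤ ε := by
        simp only [Finset.sum_const, Finset.card_univ, Fintype.card_fin, nsmul_eq_mul]
        have : K * (n * (1 / N)) ≤ ε / 2 := by
          rw [div_lt_iff₀ hε] at hN1
          rw [← mul_assoc, mul_one_div, div_le_iff₀ hN0]
          linarith
        linarith

theorem pderiv_aeval_affine {ι : Type*} [DecidableEq ι] (c d : ι → ℝ) (i : ι)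
    (p : MvPolynomial ι ℝ) :
    MvPolynomial.pderiv i (MvPolynomial.aeval
      (fun j => c j • (MvPolynomial.X j - MvPolynomial.C (d j)) : ι → MvPolynomial ι ℝ) p) =
    c i • MvPolynomial.aeval
      (fun j => c j • (MvPolynomial.X j - MvPolynomial.C (d j)) : ι → MvPolynomial ι ℝ)
      (MvPolynomial.pderiv i p) := by
  induction p using MvPolynomial.induction_on with
  | C a => simp [MvPolynomial.algebraMap_eq]
  | add p q hp hq => simp only [map_add, hp, hq, smul_add]
  | mul_X p j hp =>
    rw [map_mul, Derivation.leibniz, Derivation.leibniz, hp]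
    simp only [MvPolynomial.aeval_X, MvPolynomial.pderiv_X, map_add, smul_eq_mul, map_mul]
    by_cases h : i = j
    · subst h; simp [smul_add]
    · simp [h]

/-- An increasing continuous function on a box is a uniform limit of polynomials that are increasing
to first order on the box. -/
theorem exists_mvPolynomial_increasing_close {n : ℕ} {f : (Fin n → ℝ) → ℝ} {α β : Fin n → ℝ}
    (hf : ContinuousOn f (Set.Icc α β)) (hmono : IncreasingInEachVariableOn f (Set.Icc α β))
    {ε : ℝ} (hε : 0 < ε) :
    ∃ p : MvPolynomial (Fin n) ℝ,
      (∀ u ∈ Set.Icc α β, |MvPolynomial.eval u p - f u| ≤ ε) ∧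
      ∀ i, ∀ u ∈ Set.Icc α β, 0 ≤ MvPolynomial.eval u (MvPolynomial.pderiv i p) := by
  by_cases hαβ : α ≤ β
  swap
  · have : Set.Icc α β = ∅ := Set.Icc_eq_empty hαβ
    exact ⟨0, by simp [this], by simp⟩
  set m : (Fin n → ℝ) → Fin n → ℝ := fun v => α + (β - α) * v with hm
  have hd : 0 ≤ β - α := sub_nonneg.2 hαβ
  have hmaps : Set.MapsTo m (Set.Icc 0 1) (Set.Icc α β) := by
    intro v hv
    refine ⟨fun i => ?_, fun i => ?_⟩
    · have := mul_nonneg (hd i) (hv.1 i)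
      simp only [hm, Pi.add_apply, Pi.mul_apply] at this ⊢
      linarith
    · have := mul_le_mul_of_nonneg_left (hv.2 i) (hd i)
      simp only [hm, Pi.add_apply, Pi.mul_apply, Pi.sub_apply, Pi.one_apply, mul_one] at this ⊢
      linarith
  have hcont : ContinuousOn (f ∘ m) (Set.Icc 0 1) :=
    hf.comp (by fun_prop) hmaps
  have hinc : IncreasingInEachVariableOn (f ∘ m) (Set.Icc 0 1) := by
    intro v hv i t ht hvt
    have hu : m (Function.update v i t) = Function.update (m v) i (α i + (β i - α i) * t) := by
      ext j
      by_cases h : j = i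
      · subst h; simp [hm]
      · simp [hm, h]
    have := hmono (m v) (hmaps hv) i (α i + (β i - α i) * t) (hu ▸ hmaps ht) (by
      have := mul_le_mul_of_nonneg_left hvt (hd i)
      simp only [hm, Pi.add_apply, Pi.mul_apply, Pi.sub_apply] at this ⊢
      linarith)
    rwa [← hu] at this
  obtain ⟨N, hN⟩ := exists_mvBernstein_close hcont hε
  -- For `α i = β i` the inverse is `0`, and the rescaled coordinate is constantly `0`.
  set c : Fin n → ℝ := fun j => (β j - α j)⁻¹ with hc
  have hc0 : ∀ j, 0 ≤ c j := fun j => inv_nonneg.2 (hd j)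
  have heval : ∀ (u : Fin n → ℝ) (p : MvPolynomial (Fin n) ℝ), MvPolynomial.eval u
      (MvPolynomial.aeval (fun j => c j • (MvPolynomial.X j - MvPolynomial.C (α j)) :
        Fin n → MvPolynomial (Fin n) ℝ) p) =
      MvPolynomial.eval (fun j => c j * (u j - α j)) p := by
    intro u p
    induction p using MvPolynomial.induction_on with
    | C a => simp [MvPolynomial.algebraMap_eq]
    | add p q hp hq => simp only [map_add, hp, hq]
    | mul_X p j hp => rw [map_mul, map_mul, hp]; simp [MvPolynomial.smul_eval]
  have hcube : ∀ u ∈ Set.Icc α β, (fun j => c j * (u j - α j)) ∈ Set.Icc (0 : Fin n → ℝ) 1 := by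
    intro u hu
    refine ⟨fun j => mul_nonneg (hc0 j) (sub_nonneg.2 (hu.1 j)), fun j => ?_⟩
    simp only [hc, inv_mul_eq_div]
    exact div_le_one_of_le₀ (sub_le_sub_right (hu.2 j) _) (hd j)
  have hback : ∀ u ∈ Set.Icc α β, m (fun j => c j * (u j - α j)) = u := by
    intro u hu
    ext j
    simp only [hm, hc, Pi.add_apply, Pi.mul_apply, Pi.sub_apply]
    by_cases h : β j - α j = 0
    · have h1 := hu.1 j
      have h2 := hu.2 j
      rw [h]
      linarith
    · field_simp
      ring
  refine ⟨MvPolynomial.aeval (fun j => c j • (MvPolynomial.X j - MvPolynomial.C (α j)))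
    (mvBernstein N (f ∘ m)), fun u hu => ?_, fun i u hu => ?_⟩
  · have := hN _ (hcube u hu)
    rwa [Function.comp_apply, hback u hu, ← heval] at this
  · rw [pderiv_aeval_affine, MvPolynomial.smul_eval, heval]
    exact mul_nonneg (hc0 i) (eval_pderiv_mvBernstein_nonneg N hinc (hcube u hu) i)

/-! ### The joint functional calculus as a homomorphism -/

section FunctionalCalculus

variable {B : Type*} [CStarAlgebra B] {n : ℕ} {x : Fin n → B}

/-- An element of the algebra generated by `x` is determined by its values at characters. -/
theorem eq_jointCFC_of_forall_character (hx : IsAbelianTuple x) {f : (Fin n → ℝ) → ℝ}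
    (hf : ContinuousOn f (jointSpectrum x)) (b : generatedAlgebra x)
    (hb : ∀ χ : characterSpace ℂ (generatedAlgebra x), χ b = (f (characterPoint x χ) : ℂ)) :
    jointCFC f x = b := by
  let _ := generatedCommCStarAlgebra hx
  have h1 : (⟨jointCFC f x, jointCFC_mem f x⟩ : generatedAlgebra x) = b := by
    apply (gelfandStarTransform (generatedAlgebra x)).injective
    ext χ
    exact (character_jointCFC hx hf χ).trans (hb χ).symm
  exact congrArg Subtype.val h1

theorem jointCFC_const (hx : IsAbelianTuple x) (c : ℝ) :
    jointCFC (fun _ => c) x = algebraMap ℝ B c := by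
  refine (eq_jointCFC_of_forall_character hx continuousOn_const
    (algebraMap ℂ (generatedAlgebra x) (c : ℂ)) fun χ => ?_).trans ?_
  · rw [AlgHomClass.commutes]
    rfl
  · exact (IsScalarTower.algebraMap_apply ℝ ℂ B c).symm

theorem jointCFC_add (hx : IsAbelianTuple x) {f g : (Fin n → ℝ) → ℝ}
    (hf : ContinuousOn f (jointSpectrum x)) (hg : ContinuousOn g (jointSpectrum x)) :
    jointCFC (fun u => f u + g u) x = jointCFC f x + jointCFC g x := by
  refine eq_jointCFC_of_forall_character hx (hf.add hg)
    (⟨jointCFC f x, jointCFC_mem f x⟩ + ⟨jointCFC g x, jointCFC_mem g x⟩) fun χ => ?_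
  rw [map_add, character_jointCFC hx hf, character_jointCFC hx hg]
  exact (Complex.ofReal_add _ _).symm

theorem jointCFC_mul (hx : IsAbelianTuple x) {f g : (Fin n → ℝ) → ℝ}
    (hf : ContinuousOn f (jointSpectrum x)) (hg : ContinuousOn g (jointSpectrum x)) :
    jointCFC (fun u => f u * g u) x = jointCFC f x * jointCFC g x := by
  refine eq_jointCFC_of_forall_character hx (hf.mul hg)
    (⟨jointCFC f x, jointCFC_mem f x⟩ * ⟨jointCFC g x, jointCFC_mem g x⟩) fun χ => ?_
  rw [map_mul, character_jointCFC hx hf, character_jointCFC hx hg]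
  exact (Complex.ofReal_mul _ _).symm

theorem isSelfAdjoint_jointCFC (hx : IsAbelianTuple x) {f : (Fin n → ℝ) → ℝ}
    (hf : ContinuousOn f (jointSpectrum x)) : IsSelfAdjoint (jointCFC f x) := by
  refine (eq_jointCFC_of_forall_character hx hf
    (star ⟨jointCFC f x, jointCFC_mem f x⟩) fun χ => ?_).symm
  rw [map_star, character_jointCFC hx hf]
  exact Complex.conj_ofReal _

theorem norm_jointCFC_sub_le (hx : IsAbelianTuple x) {f g : (Fin n → ℝ) → ℝ}
    (hf : ContinuousOn f (jointSpectrum x)) (hg : ContinuousOn g (jointSpectrum x)) {ε : ℝ}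
    (hε : 0 ≤ ε) (h : ∀ u ∈ jointSpectrum x, |f u - g u| ≤ ε) :
    ‖jointCFC f x - jointCFC g x‖ ≤ ε := by
  let _ := generatedCommCStarAlgebra hx
  let a : generatedAlgebra x := ⟨jointCFC f x, jointCFC_mem f x⟩ - ⟨jointCFC g x, jointCFC_mem g x⟩
  change ‖a‖ ≤ ε
  rw [← (gelfandTransform_isometry (generatedAlgebra x)).norm_map_of_map_zero (map_zero _) a,
    ContinuousMap.norm_le _ hε]
  intro χ
  have : gelfandTransform ℂ (generatedAlgebra x) a χ =
      ((f (characterPoint x χ) - g (characterPoint x χ) : ℝ) : ℂ) := by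
    change χ (_ - _) = _
    rw [map_sub, character_jointCFC hx hf, character_jointCFC hx hg]
    push_cast
    rfl
  rw [this, Complex.norm_real]
  exact h _ ⟨χ, rfl⟩

theorem generatedAlgebra_le {S : StarSubalgebra ℂ B} (hS : IsClosed (S : Set B))
    (hx : ∀ i, x i ∈ S) : generatedAlgebra x ≤ S :=
  StarSubalgebra.topologicalClosure_minimal
    (StarAlgebra.adjoin_le (by rintro _ ⟨i, rfl⟩; exact hx i)) hS

theorem commute_jointCFC (hx : IsAbelianTuple x) (f : (Fin n → ℝ) → ℝ) (i : Fin n) :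
    Commute (jointCFC f x) (x i) :=
  congrArg Subtype.val (generatedAlgebra_mul_comm hx ⟨_, jointCFC_mem f x⟩
    ⟨_, mem_generatedAlgebra x i⟩)

/-- The value `p(x)` of a real polynomial at an abelian tuple `x`. It is read off from the
functional calculus, as evaluation of an `MvPolynomial` would need a commutative target algebra. -/
noncomputable abbrev polyCFC (p : MvPolynomial (Fin n) ℝ) (x : Fin n → B) : B :=
  jointCFC (fun u => MvPolynomial.eval u p) x

theorem polyCFC_C (hx : IsAbelianTuple x) (c : ℝ) :
    polyCFC (MvPolynomial.C c) x = algebraMap ℝ B c := by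
  simp only [polyCFC, MvPolynomial.eval_C, jointCFC_const hx]

theorem polyCFC_X (hx : IsAbelianTuple x) (i : Fin n) :
    polyCFC (MvPolynomial.X i) x = x i := by
  simp only [polyCFC, MvPolynomial.eval_X, jointCFC_coord hx]

theorem polyCFC_add (hx : IsAbelianTuple x) (p q : MvPolynomial (Fin n) ℝ) :
    polyCFC (p + q) x = polyCFC p x + polyCFC q x := by
  simp only [polyCFC, map_add]
  exact jointCFC_add hx (MvPolynomial.continuous_eval p).continuousOn
    (MvPolynomial.continuous_eval q).continuousOn

theorem polyCFC_mul (hx : IsAbelianTuple x) (p q : MvPolynomial (Fin n) ℝ) :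
    polyCFC (p * q) x = polyCFC p x * polyCFC q x := by
  simp only [polyCFC, map_mul]
  exact jointCFC_mul hx (MvPolynomial.continuous_eval p).continuousOn
    (MvPolynomial.continuous_eval q).continuousOn

end FunctionalCalculus

/-! ### Positive functionals and their centralizers -/

section Functional

variable {B : Type*} [CStarAlgebra B] {A : NonUnitalStarSubalgebra ℂ B}

/-- A positive functional on a closed `*`-subalgebra is bounded and hermitian. -/
theorem IsPositiveFunctional.continuous_and_map_star (hA : IsClosed (A : Set B))
    {φ : A →ₗ[ℂ] ℂ} (hφ : IsPositiveFunctional φ) :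
    Continuous φ ∧ ∀ a, φ (star a) = star (φ a) := by
  have : IsClosed (A : Set B) := hA
  let _ : NonUnitalCStarAlgebra A := NonUnitalStarSubalgebra.nonUnitalCStarAlgebra A
  let _ : PartialOrder A := CStarAlgebra.spectralOrder A
  have : StarOrderedRing A := CStarAlgebra.spectralOrderedRing A
  let Ψ : A →ₚ[ℂ] ℂ := PositiveLinearMap.mk₀ φ fun a ha => by
    obtain ⟨b, rfl⟩ := CStarAlgebra.nonneg_iff_eq_star_mul_self.1 ha
    exact hφ b
  exact ⟨map_continuous Ψ, fun a => map_star Ψ a⟩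

/-- The elements `b` that multiply `A` into itself and satisfy `Φ (a * b) = Φ (b * a)` for `a` in
`A`. It contains the centralizer of the restriction of `Φ` to `A`, and also the unit of `B`. -/
def relativeCentralizer (A : NonUnitalStarSubalgebra ℂ B) (Φ : B →ₗ[ℂ] ℂ)
    (hΦ : ∀ a ∈ A, Φ (star a) = star (Φ a)) : StarSubalgebra ℂ B where
  carrier := {b | ∀ a ∈ A, a * b ∈ A ∧ b * a ∈ A ∧ Φ (a * b) = Φ (b * a)}
  mul_mem' {b c} hb hc a ha := by
    have h1 := hb a ha
    have h2 := hc a ha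
    refine ⟨?_, ?_, ?_⟩
    · rw [← mul_assoc]; exact (hc _ h1.1).1
    · rw [mul_assoc]; exact (hb _ h2.2.1).2.1
    · rw [← mul_assoc, (hc _ h1.1).2.2, ← mul_assoc, (hb _ h2.2.1).2.2, mul_assoc]
  add_mem' {b c} hb hc a ha := by
    have h1 := hb a ha
    have h2 := hc a ha
    refine ⟨?_, ?_, ?_⟩
    · rw [mul_add]; exact add_mem h1.1 h2.1
    · rw [add_mul]; exact add_mem h1.2.1 h2.2.1
    · rw [mul_add, add_mul, map_add, map_add, h1.2.2, h2.2.2]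
  algebraMap_mem' r a ha := by
    rw [← Algebra.commutes r a, ← Algebra.smul_def]
    exact ⟨A.smul_mem r ha, A.smul_mem r ha, rfl⟩
  star_mem' {b} hb a ha := by
    have h := hb (star a) (star_mem ha)
    have e1 : a * star b = star (b * star a) := by simp
    have e2 : star b * a = star (star a * b) := by simp
    refine ⟨e1 ▸ star_mem h.2.1, e2 ▸ star_mem h.1, ?_⟩
    rw [e1, e2, hΦ _ h.2.1, hΦ _ h.1, h.2.2]

theorem isClosed_relativeCentralizer (hA : IsClosed (A : Set B)) (Φ : B →L[ℂ] ℂ)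
    (hΦ : ∀ a ∈ A, (Φ : B →ₗ[ℂ] ℂ) (star a) = star ((Φ : B →ₗ[ℂ] ℂ) a)) :
    IsClosed (relativeCentralizer A (Φ : B →ₗ[ℂ] ℂ) hΦ : Set B) := by
  have : (relativeCentralizer A (Φ : B →ₗ[ℂ] ℂ) hΦ : Set B) =
      ⋂ a ∈ A, {b | a * b ∈ A} ∩ ({b | b * a ∈ A} ∩ {b | Φ (a * b) = Φ (b * a)}) := by
    ext b
    simp only [Set.mem_iInter]
    rfl
  rw [this]
  refine isClosed_biInter fun a _ => (hA.preimage (by fun_prop : Continuous fun b => a * b)).inter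
    ((hA.preimage (by fun_prop : Continuous fun b => b * a)).inter
      (isClosed_eq (by fun_prop) (by fun_prop)))

/-- The product of a positive element of `A` in the centralizer with `star h * h` has nonnegative
value, as it has the same value as `star (h * s) * (h * s)` with `s` the square root. -/
theorem nonneg_map_star_mul_self_mul [PartialOrder B] [StarOrderedRing B]
    (hA : IsClosed (A : Set B)) {Φ : B →L[ℂ] ℂ}
    (hΦ : ∀ a ∈ A, (Φ : B →ₗ[ℂ] ℂ) (star a) = star ((Φ : B →ₗ[ℂ] ℂ) a))
    (hpos : ∀ a ∈ A, 0 ≤ Φ (star a * a)) {h d : B}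
    (hh : h ∈ relativeCentralizer A (Φ : B →ₗ[ℂ] ℂ) hΦ)
    (hd : d ∈ relativeCentralizer A (Φ : B →ₗ[ℂ] ℂ) hΦ) (hdA : d ∈ A) (hd0 : 0 ≤ d) :
    0 ≤ Φ (star h * h * d) := by
  have hN := isClosed_relativeCentralizer hA Φ hΦ
  set s := CFC.sqrt d with hs
  have hsd : s * s = d := CFC.sqrt_mul_sqrt_self d
  have hsA : s ∈ A := by
    rw [hs, CFC.sqrt_eq_real_sqrt d]
    exact cfcₙ_mem (𝕜' := ℂ) _ hdA
  have hsN : s ∈ relativeCentralizer A (Φ : B →ₗ[ℂ] ℂ) hΦ := by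
    rw [hs, CFC.sqrt_eq_real_sqrt d]
    exact cfcₙ_mem (𝕜' := ℂ) _ hd
  have hs_star : star s = s := (CFC.sqrt_nonneg d).isSelfAdjoint.star_eq
  have h1 : h * s ∈ A := (hh s hsA).2.1
  have h2 : star h * h * s ∈ A := by
    rw [mul_assoc]
    exact (star_mem hh _ h1).2.1
  have e : Φ (star h * h * d) = Φ (star (h * s) * (h * s)) := by
    rw [← hsd, ← mul_assoc, star_mul, hs_star]
    refine ((hsN _ h2).2.2).trans ?_
    simp only [mul_assoc]
    rfl
  rw [e]
  exact hpos _ h1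

end Functional

/-! ### Monotonicity along the segment -/

section Segment

variable {B : Type*} [CStarAlgebra B] {A : NonUnitalStarSubalgebra ℂ B} {n : ℕ}

/-- Compatible tuples span an affine line of abelian tuples: the commutator of two coordinates is a
quadratic polynomial in the parameter which vanishes at `0`, `1/2` and `1`. -/
theorem AreCompatible.isAbelianTuple {x y : Fin n → B} (hx : IsAbelianTuple x)
    (hy : IsAbelianTuple y) (h : AreCompatible x y) (t : ℝ) :
    IsAbelianTuple ((1 - t) • x + t • y) := by
  refine ⟨fun i => ?_, fun i j => ?_⟩
  · have h1 := hx.isSelfAdjoint i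
    have h2 := hy.isSelfAdjoint i
    exact ((IsSelfAdjoint.all (1 - t)).smul h1).add ((IsSelfAdjoint.all t).smul h2)
  · have hhalf := (h (1 / 2) (by norm_num)).commute i j
    have hcross : x i * y j + y i * x j = x j * y i + y j * x i := by
      have h4 := congrArg (fun b => (4 : ℝ) • b) hhalf
      simp only [Pi.add_apply, Pi.smul_apply, add_mul, mul_add, smul_mul_smul_comm, smul_add,
        smul_smul, hx.commute i j, hy.commute i j] at h4
      norm_num at h4
      have : x j * x i + (x i * y j + y i * x j) + y j * y i =
          x j * x i + (x j * y i + y j * x i) + y j * y i := by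
        convert h4 using 1 <;> abel
      exact add_left_cancel (add_right_cancel this)
    have hexp : ∀ i j : Fin n, ((1 - t) • x + t • y) i * ((1 - t) • x + t • y) j =
        ((1 - t) * (1 - t)) • (x i * x j) + ((1 - t) * t) • (x i * y j + y i * x j)
          + (t * t) • (y i * y j) := by
      intro i j
      simp only [Pi.add_apply, Pi.smul_apply, add_mul, mul_add, smul_mul_smul_comm, smul_add]
      rw [mul_comm t (1 - t)]
      abel
    rw [hexp, hexp, hx.commute i j, hy.commute i j, hcross]

theorem hasDerivAt_segment (x y : B) (t : ℝ) :
    HasDerivAt (fun s : ℝ => (1 - s) • x + s • y) (y - x) t := by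
  have h1 := ((hasDerivAt_id t).const_sub 1).smul_const x
  have h2 := (hasDerivAt_id t).smul_const y
  exact (h1.add h2).congr_deriv (by rw [neg_one_smul, one_smul, neg_add_eq_sub])

variable {Φ : B →L[ℂ] ℂ}
  {hΦ : ∀ a ∈ A, (Φ : B →ₗ[ℂ] ℂ) (star a) = star ((Φ : B →ₗ[ℂ] ℂ) a)}

theorem jointCFC_mem_relativeCentralizer (hA : IsClosed (A : Set B)) {x : Fin n → B}
    (hx : ∀ i, x i ∈ relativeCentralizer A (Φ : B →ₗ[ℂ] ℂ) hΦ) (f : (Fin n → ℝ) → ℝ) :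
    jointCFC f x ∈ relativeCentralizer A (Φ : B →ₗ[ℂ] ℂ) hΦ :=
  generatedAlgebra_le (isClosed_relativeCentralizer hA Φ hΦ) hx (jointCFC_mem f x)

/-- The chain rule under a functional: the derivative `D` of `p (X s)` is a sum of words in which
one factor `X s j` is replaced by its derivative `d j`, and since the functional is tracial on such
words, it does not distinguish `D` from `∑ i, (∂ᵢ p) (X s) * d i`. The auxiliary factor `a`
makes the induction on `p` work. -/
theorem exists_hasDerivAt_polyCFC (hA : IsClosed (A : Set B)) {X : ℝ → Fin n → B} {d : Fin n → B}
    (hX : ∀ t, IsAbelianTuple (X t)) (hXd : ∀ t i, HasDerivAt (fun s => X s i) (d i) t)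
    (hXN : ∀ t i, X t i ∈ relativeCentralizer A (Φ : B →ₗ[ℂ] ℂ) hΦ) (hd : ∀ i, d i ∈ A)
    (t : ℝ) (p : MvPolynomial (Fin n) ℝ) :
    ∃ D ∈ A, HasDerivAt (fun s => polyCFC p (X s)) D t ∧
      ∀ a ∈ relativeCentralizer A (Φ : B →ₗ[ℂ] ℂ) hΦ, (∀ i, Commute a (X t i)) →
        Φ (a * D) = ∑ i, Φ (a * polyCFC (MvPolynomial.pderiv i p) (X t) * d i) := by
  induction p using MvPolynomial.induction_on with
  | C c =>
    refine ⟨0, zero_mem _, ?_, fun a _ _ => ?_⟩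
    · simp only [polyCFC_C (hX _)]
      exact hasDerivAt_const _ _
    · have : polyCFC 0 (X t) = 0 := by
        have := polyCFC_C (hX t) 0
        rwa [map_zero, map_zero] at this
      simp [this]
  | add p q hp hq =>
    obtain ⟨D, hDA, hD, hDΦ⟩ := hp
    obtain ⟨E, hEA, hE, hEΦ⟩ := hq
    refine ⟨D + E, add_mem hDA hEA, ?_, fun a ha hac => ?_⟩
    · simp only [polyCFC_add (hX _)]
      exact hD.add hE
    · rw [mul_add, map_add, hDΦ a ha hac, hEΦ a ha hac, ← Finset.sum_add_distrib]
      refine Finset.sum_congr rfl fun i _ => ?_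
      rw [map_add, polyCFC_add (hX t), mul_add, add_mul, map_add]
  | mul_X p j hp =>
    obtain ⟨D, hDA, hD, hDΦ⟩ := hp
    have hpN := jointCFC_mem_relativeCentralizer hA (hXN t) (fun u => MvPolynomial.eval u p)
    refine ⟨D * X t j + polyCFC p (X t) * d j,
      add_mem (hXN t j D hDA).1 (hpN _ (hd j)).2.1, ?_, fun a ha hac => ?_⟩
    · simp only [polyCFC_mul (hX _), polyCFC_X (hX _)]
      exact hD.mul (hXd t j)
    · have h1 : Φ (a * (D * X t j)) =
          ∑ i, Φ (a * (polyCFC (MvPolynomial.pderiv i p) (X t) * X t j) * d i) := by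
        have hcyc : Φ (a * D * X t j) = Φ (X t j * (a * D)) :=
          (hXN t j _ (ha D hDA).2.1).2.2
        rw [← mul_assoc, hcyc, ← mul_assoc,
          hDΦ _ (mul_mem (hXN t j) ha) fun i => (show Commute _ _ from (hX t).commute j i).mul_left
            (hac i)]
        refine Finset.sum_congr rfl fun i _ => ?_
        rw [← (hac j).eq, mul_assoc a, (commute_jointCFC (hX t) _ j).eq]
      have h2 : ∀ i, polyCFC (MvPolynomial.pderiv i (p * MvPolynomial.X j)) (X t) =
          polyCFC (MvPolynomial.pderiv i p) (X t) * X t j +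
            if i = j then polyCFC p (X t) else 0 := by
        intro i
        have h0 : polyCFC 0 (X t) = 0 := by
          have := polyCFC_C (hX t) 0
          rwa [map_zero, map_zero] at this
        rw [Derivation.leibniz, polyCFC_add (hX t), MvPolynomial.pderiv_X, smul_eq_mul,
          smul_eq_mul, polyCFC_mul (hX t), polyCFC_mul (hX t), polyCFC_X (hX t),
          ← (commute_jointCFC (hX t) _ j).eq, add_comm]
        by_cases h : i = j
        · subst h
          have h1 : polyCFC 1 (X t) = 1 := by
            have := polyCFC_C (hX t) 1
            rwa [map_one, map_one] at this
          simp [h1]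
        · simp [h, h0]
      simp only [h2, mul_add, add_mul, map_add, Finset.sum_add_distrib, h1]
      simp [mul_assoc, apply_ite, ite_mul]

/-- The constant terms cancel, so the difference lies in `A` even when `A` does not contain the
unit. -/
theorem polyCFC_sub_mem (hA : IsClosed (A : Set B)) {x y : Fin n → B}
    (hx : IsAbelianTuple x) (hy : IsAbelianTuple y)
    (hxN : ∀ i, x i ∈ relativeCentralizer A (Φ : B →ₗ[ℂ] ℂ) hΦ)
    (hyN : ∀ i, y i ∈ relativeCentralizer A (Φ : B →ₗ[ℂ] ℂ) hΦ)
    (hxA : ∀ i, x i ∈ A) (hyA : ∀ i, y i ∈ A) (p : MvPolynomial (Fin n) ℝ) :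
    polyCFC p y - polyCFC p x ∈ A := by
  induction p using MvPolynomial.induction_on with
  | C c => rw [polyCFC_C hx, polyCFC_C hy, sub_self]; exact zero_mem _
  | add p q hp hq =>
    rw [polyCFC_add hx, polyCFC_add hy, add_sub_add_comm]
    exact add_mem hp hq
  | mul_X p j hp =>
    rw [polyCFC_mul hx, polyCFC_mul hy, polyCFC_X hx, polyCFC_X hy]
    exact sub_mem (jointCFC_mem_relativeCentralizer hA hyN _ _ (hyA j)).2.1
      (jointCFC_mem_relativeCentralizer hA hxN _ _ (hxA j)).2.1

variable [PartialOrder B] [StarOrderedRing B]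

theorem segment_bounds {x y a b : B} (hax : a ≤ x) (hxy : x ≤ y) (hyb : y ≤ b) {t : ℝ}
    (ht : t ∈ Set.Icc (0 : ℝ) 1) : a ≤ (1 - t) • x + t • y ∧ (1 - t) • x + t • y ≤ b := by
  have hd : 0 ≤ y - x := sub_nonneg.2 hxy
  have h1 : (1 - t) • x + t • y = x + t • (y - x) := by
    rw [sub_smul, one_smul, smul_sub]; abel
  have h2 : (1 - t) • x + t • y = y - (1 - t) • (y - x) := by
    rw [smul_sub, sub_smul, sub_smul, one_smul, one_smul]; abel
  constructor
  · rw [h1]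
    exact hax.trans (le_add_of_nonneg_right (smul_nonneg ht.1 hd))
  · rw [h2]
    exact (sub_le_self _ (smul_nonneg (sub_nonneg.2 ht.2) hd)).trans hyb

/-- For `p` increasing to first order, `t ↦ Φ (p (x + t (y - x)))` has derivative
`∑ i, Φ ((∂ᵢ p) (x + t (y - x)) * (y i - x i)) ≥ 0` on `[0, 1]`. -/
theorem re_polyCFC_sub_nonneg (hA : IsClosed (A : Set B))
    (hpos : ∀ a ∈ A, 0 ≤ Φ (star a * a)) {x y : Fin n → B} {α β : Fin n → ℝ}
    (hx : IsAbelianTuple x) (hy : IsAbelianTuple y) (hxy : AreCompatible x y)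
    (hα : ∀ i, algebraMap ℝ B (α i) ≤ x i) (hle : ∀ i, x i ≤ y i)
    (hβ : ∀ i, y i ≤ algebraMap ℝ B (β i))
    (hxN : ∀ i, x i ∈ relativeCentralizer A (Φ : B →ₗ[ℂ] ℂ) hΦ)
    (hyN : ∀ i, y i ∈ relativeCentralizer A (Φ : B →ₗ[ℂ] ℂ) hΦ)
    (hxA : ∀ i, x i ∈ A) (hyA : ∀ i, y i ∈ A) (p : MvPolynomial (Fin n) ℝ)
    (hp : ∀ i, ∀ u ∈ Set.Icc α β, 0 ≤ MvPolynomial.eval u (MvPolynomial.pderiv i p)) :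
    0 ≤ (Φ (polyCFC p y - polyCFC p x)).re := by
  set X : ℝ → Fin n → B := fun t => (1 - t) • x + t • y with hXdef
  have hX : ∀ t, IsAbelianTuple (X t) := fun t => hxy.isAbelianTuple hx hy t
  have hXN : ∀ t i, X t i ∈ relativeCentralizer A (Φ : B →ₗ[ℂ] ℂ) hΦ := by
    intro t i
    have hsm : ∀ (r : ℝ) (b : B), r • b = (r : ℂ) • b := fun r b => (Complex.coe_smul r b).symm
    simp only [hXdef, Pi.add_apply, Pi.smul_apply, hsm]
    exact add_mem (SMulMemClass.smul_mem _ (hxN i)) (SMulMemClass.smul_mem _ (hyN i))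
  have hdA : ∀ i, y i - x i ∈ A := fun i => sub_mem (hyA i) (hxA i)
  have hdN : ∀ i, y i - x i ∈ relativeCentralizer A (Φ : B →ₗ[ℂ] ℂ) hΦ := fun i =>
    sub_mem (hyN i) (hxN i)
  choose D hDA hD hDΦ using fun t => exists_hasDerivAt_polyCFC hA hX
    (fun t i => hasDerivAt_segment (x i) (y i) t) hXN hdA t p
  have hderiv : ∀ t, HasDerivAt (fun s => (Φ (polyCFC p (X s))).re) (Φ (D t)).re t := fun t =>
    (((Complex.reCLM.comp (Φ.restrictScalars ℝ)).hasFDerivAt).comp_hasDerivAt t (hD t))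
  have hnonneg : ∀ t ∈ Set.Icc (0 : ℝ) 1, 0 ≤ (Φ (D t)).re := by
    intro t ht
    have hsub : jointSpectrum (X t) ⊆ Set.Icc α β := jointSpectrum_subset_Icc (hX t)
      (fun i => (segment_bounds (hα i) (hle i) (hβ i) ht).1)
      (fun i => (segment_bounds (hα i) (hle i) (hβ i) ht).2)
    have h1 := hDΦ t 1 (one_mem _) fun i => Commute.one_left _
    simp only [one_mul] at h1
    rw [h1, Complex.re_sum]
    refine Finset.sum_nonneg fun i _ => ?_
    -- The square root of `(∂ᵢ p) (X t)` is taken in the functional calculus of `X t`.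
    have hc : ContinuousOn (fun u => √(MvPolynomial.eval u (MvPolynomial.pderiv i p)))
        (jointSpectrum (X t)) := (MvPolynomial.continuous_eval _).sqrt.continuousOn
    set h := jointCFC (fun u => √(MvPolynomial.eval u (MvPolynomial.pderiv i p))) (X t) with hh
    have hsq : polyCFC (MvPolynomial.pderiv i p) (X t) = star h * h := by
      rw [(isSelfAdjoint_jointCFC (hX t) hc).star_eq, hh, ← jointCFC_mul (hX t) hc hc]
      refine sub_eq_zero.1 (norm_le_zero_iff.1 (norm_jointCFC_sub_le (hX t)
        (MvPolynomial.continuous_eval _).continuousOn (hc.mul hc) le_rfl fun u hu => ?_))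
      rw [Pi.mul_apply, Real.mul_self_sqrt (hp i u (hsub hu)), sub_self, abs_zero]
    rw [hsq]
    exact (Complex.le_def.1 (nonneg_map_star_mul_self_mul hA hΦ hpos
      (jointCFC_mem_relativeCentralizer hA (hXN t) _) (hdN i) (hdA i)
      (sub_nonneg.2 (hle i)))).1
  have hmono := monotoneOn_of_deriv_nonneg (convex_Icc (0 : ℝ) 1)
    (fun t _ => (hderiv t).continuousAt.continuousWithinAt)
    (fun t _ => (hderiv t).differentiableAt.differentiableWithinAt)
    (fun t ht => by
      rw [(hderiv t).deriv]
      exact hnonneg t (interior_subset ht))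
  have h01 := hmono (Set.left_mem_Icc.2 zero_le_one) (Set.right_mem_Icc.2 zero_le_one) zero_le_one
  have hX0 : X 0 = x := by simp [hXdef]
  have hX1 : X 1 = y := by simp [hXdef]
  simp only [hX0, hX1] at h01
  rw [map_sub, Complex.sub_re]
  exact sub_nonneg.2 h01

/-- Passage from polynomials to continuous functions: only elements of the closed set `A` are
evaluated, so no value of the functional at the unit of `B` enters. -/
theorem jointCFC_sub_mem_and_nonneg (hA : IsClosed (A : Set B))
    (hpos : ∀ a ∈ A, 0 ≤ Φ (star a * a)) {x y : Fin n → B} {α β : Fin n → ℝ}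
    (hx : IsAbelianTuple x) (hy : IsAbelianTuple y) (hxy : AreCompatible x y)
    (hα : ∀ i, algebraMap ℝ B (α i) ≤ x i) (hle : ∀ i, x i ≤ y i)
    (hβ : ∀ i, y i ≤ algebraMap ℝ B (β i))
    (hxN : ∀ i, x i ∈ relativeCentralizer A (Φ : B →ₗ[ℂ] ℂ) hΦ)
    (hyN : ∀ i, y i ∈ relativeCentralizer A (Φ : B →ₗ[ℂ] ℂ) hΦ)
    (hxA : ∀ i, x i ∈ A) (hyA : ∀ i, y i ∈ A) {f : (Fin n → ℝ) → ℝ}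
    (hf : ContinuousOn f (Set.Icc α β)) (hmono : IncreasingInEachVariableOn f (Set.Icc α β)) :
    jointCFC f y - jointCFC f x ∈ A ∧ 0 ≤ Φ (jointCFC f y - jointCFC f x) := by
  have hxs : jointSpectrum x ⊆ Set.Icc α β :=
    jointSpectrum_subset_Icc hx hα fun i => (hle i).trans (hβ i)
  have hys : jointSpectrum y ⊆ Set.Icc α β :=
    jointSpectrum_subset_Icc hy (fun i => (hα i).trans (hle i)) hβ
  have hclosed : IsClosed ((A : Set B) ∩ {b | 0 ≤ (Φ b).re}) :=
    hA.inter (isClosed_le continuous_const (Complex.continuous_re.comp Φ.continuous))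
  have hmem : jointCFC f y - jointCFC f x ∈ (A : Set B) ∩ {b | 0 ≤ (Φ b).re} := by
    rw [← hclosed.closure_eq, Metric.mem_closure_iff]
    intro ε hε
    obtain ⟨p, hpf, hp⟩ := exists_mvPolynomial_increasing_close hf hmono (by positivity : 0 < ε / 3)
    refine ⟨polyCFC p y - polyCFC p x, ⟨polyCFC_sub_mem hA hx hy hxN hyN hxA hyA p,
      re_polyCFC_sub_nonneg hA hpos hx hy hxy hα hle hβ hxN hyN hxA hyA p hp⟩, ?_⟩
    have hclose : ∀ {z : Fin n → B}, IsAbelianTuple z → jointSpectrum z ⊆ Set.Icc α β →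
        dist (jointCFC f z) (polyCFC p z) ≤ ε / 3 := by
      intro z hz hzs
      rw [dist_comm, dist_eq_norm]
      exact norm_jointCFC_sub_le hz (MvPolynomial.continuous_eval p).continuousOn (hf.mono hzs)
        (by positivity) fun u hu => hpf u (hzs hu)
    have := (dist_sub_sub_le (jointCFC f y) (jointCFC f x) (polyCFC p y) (polyCFC p x)).trans
      (add_le_add (hclose hy hys) (hclose hx hxs))
    linarith
  refine ⟨hmem.1, Complex.le_def.2 ⟨hmem.2, ?_⟩⟩
  have hsa : IsSelfAdjoint (jointCFC f y - jointCFC f x) :=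
    (isSelfAdjoint_jointCFC hy (hf.mono hys)).sub (isSelfAdjoint_jointCFC hx (hf.mono hxs))
  have h := hΦ _ hmem.1
  rw [hsa.star_eq] at h
  exact (Complex.conj_eq_iff_im.1 h.symm).symm

end Segment

/-! ### The inequality for increasing functions -/

theorem proposition18 {B : Type*} [CStarAlgebra B] [PartialOrder B] [StarOrderedRing B]
    (A : NonUnitalStarSubalgebra ℂ B) (hA : IsClosed (A : Set B))
    (n : ℕ) (α β : Fin n → ℝ) (f : (Fin n → ℝ) → ℝ)
    (hf : ContinuousOn f (Set.Icc α β))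
    (hmono : IncreasingInEachVariableOn f (Set.Icc α β))
    (x y : Fin n → A)
    (hx : IsAbelianTuple (fun i => (x i : B))) (hy : IsAbelianTuple (fun i => (y i : B)))
    (hxy : AreCompatible (fun i => (x i : B)) (fun i => (y i : B)))
    (hα : ∀ i, algebraMap ℝ B (α i) ≤ (x i : B))
    (hle : ∀ i, (x i : B) ≤ (y i : B))
    (hβ : ∀ i, (y i : B) ≤ algebraMap ℝ B (β i))
    (φ : A →ₗ[ℂ] ℂ) (hφ : IsPositiveFunctional φ)
    (hφx : ∀ i, x i ∈ functionalCentralizer φ) (hφy : ∀ i, y i ∈ functionalCentralizer φ) :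
    (∀ (hfx : jointCFC f (fun i => (x i : B)) ∈ A) (hfy : jointCFC f (fun i => (y i : B)) ∈ A),
      φ ⟨jointCFC f (fun i => (x i : B)), hfx⟩ ≤ φ ⟨jointCFC f (fun i => (y i : B)), hfy⟩) ∧
    (∀ ψ : B →ₗ[ℂ] ℂ, IsPositiveFunctional ψ → (∀ a : A, ψ (a : B) = φ a) →
      ψ (jointCFC f (fun i => (x i : B))) ≤ ψ (jointCFC f (fun i => (y i : B)))) := by
  obtain ⟨hcont, hstar⟩ := hφ.continuous_and_map_star hA
  -- A continuous extension to `B`; only its values on `A` are used, so it need not be positive.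
  obtain ⟨Φ, hΦφ, -⟩ := exists_extension_norm_eq A.toSubmodule (⟨φ, hcont⟩ : A →L[ℂ] ℂ)
  replace hΦφ : ∀ a : A, Φ (a : B) = φ a := hΦφ
  have hΦ : ∀ a ∈ A, (Φ : B →ₗ[ℂ] ℂ) (star a) = star ((Φ : B →ₗ[ℂ] ℂ) a) := fun a ha =>
    (hΦφ (star ⟨a, ha⟩)).trans ((hstar ⟨a, ha⟩).trans (congrArg star (hΦφ ⟨a, ha⟩).symm))
  have hpos : ∀ a ∈ A, 0 ≤ Φ (star a * a) := fun a ha =>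
    (hφ ⟨a, ha⟩).trans_eq (hΦφ (star ⟨a, ha⟩ * ⟨a, ha⟩)).symm
  have hcentral : ∀ z ∈ functionalCentralizer φ,
      (z : B) ∈ relativeCentralizer A (Φ : B →ₗ[ℂ] ℂ) hΦ := fun z hz a ha =>
    ⟨mul_mem ha z.2, mul_mem z.2 ha, (hΦφ (⟨a, ha⟩ * z)).trans
      ((hz ⟨a, ha⟩).trans (hΦφ (z * ⟨a, ha⟩)).symm)⟩
  obtain ⟨hmem, hnonneg⟩ := jointCFC_sub_mem_and_nonneg hA hpos hx hy hxy hα hle hβ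
    (fun i => hcentral _ (hφx i)) (fun i => hcentral _ (hφy i)) (fun i => (x i).2)
    (fun i => (y i).2) hf hmono
  have hφ0 : 0 ≤ φ ⟨_, hmem⟩ := hnonneg.trans_eq (hΦφ ⟨_, hmem⟩)
  refine ⟨fun hfx hfy => ?_, fun ψ _ hψ => ?_⟩
  · rw [← sub_nonneg, ← map_sub]
    exact hφ0
  · rw [← sub_nonneg, ← map_sub]
    exact hφ0.trans_eq (hψ ⟨_, hmem⟩).symm
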